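/- Let $N\ge 1$, let $1\le p<\infty$ and let $K\subset\mathbf R^N$ be compact. For an open set $\Omega\subset\mathbf R^N$ let $W^{1,p}(\Omega,\mathbf R^N)$ be the set of functions $u:\mathbf R^N\to\mathbf R$ whose restriction to $\Omega$ lies in $L^p(\Omega)$ and has weak first partial derivatives in $L^p(\Omega)$, and put $W^{1,p}(\mathbf R^N)=W^{1,p}(\mathbf R^N,\mathbf R^N)$. The $(1,p)$-capacity of a compact set $F\subset\mathbf R^N$ is $$C_{1,p}(F)=\inf\Big\{\|\varphi\|_{L^p(\mathbf R^N)}+\sum_{j=1}^N\|D_j\varphi\|_{L^p(\mathbf R^N)}:\ \varphi\in C_c^\infty(\mathbf R^N),\ \varphi\ge 1\text{ on }F\Big\},$$ and for an open set $\omega$ one puts $C_{1,p}(\omega)=\sup\{C_{1,p}(F):F\subset\omega\text{ compact}\}$. Let $Q$ be the set of Lebesgue measurable functions $u:\mathbf R^N\to\mathbf R$ that are quasicontinuous: for every $\varepsilon>0$ there is an open set $\omega$ with $C_{1,p}(\omega)<\varepsilon$ such that the restriction of $u$ to $\mathbf R^N\setminus\omega$ is continuous. The compact set $K$ has the $J_p$-property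 if $$Q\cap W^{1,p}(\mathbf R^N\setminus K,\mathbf R^N)=Q\cap W^{1,p}(\mathbf R^N),$$ and the $J_p(\mathrm{cont})$-property if the same equality holds with $Q$ replaced by the set $C(\mathbf R^N)$ of real continuous functions on $\mathbf R^N$. (i) If the $J_p$-property fails for $K$, or if the $J_p(\mathrm{cont})$-property fails for $K$, then there are a vector $v\ne 0$ and a Borel set $A$ in the hyperplane $v^\perp$ of positive $(N-1)$-dimensional Lebesgue measure such that for every $y\in A$ the line $y+\mathbf Rv$ meets $K$ in uncountably many points. (For $N=1$ the hyperplane is a single point, of measure $1$.) (ii) A singular function on a line has uncountable support: if $f:\mathbf R\to\mathbf R$ is continuous and not constant and $f'(t)=0$ for almost every $t$, then the set of points of $\mathbf R$ that have no neighbourhood on which $f$ is constant is uncountable. -/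

import Mathlib

open MeasureTheory Set Filter Topology
open scoped ContDiff ENNReal

noncomputable section

namespace SobolevRemovability

/-- The `j`-th classical partial derivative of a function on `ℝ^N`. -/
def partialDeriv {N : ℕ} (j : Fin N) (φ : EuclideanSpace ℝ (Fin N) → ℝ)
    (x : EuclideanSpace ℝ (Fin N)) : ℝ :=
  fderiv ℝ φ x (EuclideanSpace.single j 1)

/-- `g` is a weak `j`-th partial derivative of `u` on the open set `Ω`, tested against
`C_c^∞(Ω)`. (It is used only for `u` and `g` in `L^p(Ω)`, `p ≥ 1`, so both integrals converge.) -/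
def IsWeakPartialDeriv {N : ℕ} (Ω : Set (EuclideanSpace ℝ (Fin N))) (j : Fin N)
    (u g : EuclideanSpace ℝ (Fin N) → ℝ) : Prop :=
  ∀ φ : EuclideanSpace ℝ (Fin N) → ℝ, ContDiff ℝ ∞ φ → HasCompactSupport φ → tsupport φ ⊆ Ω →
    ∫ x in Ω, u x * partialDeriv j φ x = - ∫ x in Ω, g x * φ x

/-- The functions `u : ℝ^N → ℝ` whose restriction to the open set `Ω` lies in the Sobolev space
`W^{1,p}(Ω)`. For `Ω = ℝ^N` this is `W^{1,p}(ℝ^N)`. Members are functions, not classes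
modulo null sets. -/
def sobolev {N : ℕ} (p : ℝ) (Ω : Set (EuclideanSpace ℝ (Fin N))) :
    Set (EuclideanSpace ℝ (Fin N) → ℝ) :=
  {u | MemLp u (ENNReal.ofReal p) (volume.restrict Ω) ∧
    ∀ j : Fin N, ∃ g : EuclideanSpace ℝ (Fin N) → ℝ,
      MemLp g (ENNReal.ofReal p) (volume.restrict Ω) ∧ IsWeakPartialDeriv Ω j u g}

/-- The `(1,p)`-capacity of a compact set `F`: the infimum of
`‖φ‖_p + ∑_j ‖D_j φ‖_p` over `φ ∈ C_c^∞(ℝ^N)` with `φ ≥ 1` on `F`. -/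
def capCompact {N : ℕ} (p : ℝ) (F : Set (EuclideanSpace ℝ (Fin N))) : ℝ≥0∞ :=
  ⨅ (φ : EuclideanSpace ℝ (Fin N) → ℝ) (_ : ContDiff ℝ ∞ φ) (_ : HasCompactSupport φ)
    (_ : ∀ x ∈ F, 1 ≤ φ x),
    (eLpNorm φ (ENNReal.ofReal p) volume +
      ∑ j : Fin N, eLpNorm (partialDeriv j φ) (ENNReal.ofReal p) volume)

/-- The `(1,p)`-capacity of an open set: the supremum over its compact subsets. -/
def capOpen {N : ℕ} (p : ℝ) (U : Set (EuclideanSpace ℝ (Fin N))) : ℝ≥0∞ :=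
  ⨆ (F : Set (EuclideanSpace ℝ (Fin N))) (_ : IsCompact F) (_ : F ⊆ U), capCompact p F

/-- The Lebesgue measurable functions on `ℝ^N` that are quasicontinuous with respect to the
`(1,p)`-capacity. -/
def quasicontinuous (N : ℕ) (p : ℝ) : Set (EuclideanSpace ℝ (Fin N) → ℝ) :=
  {u | AEMeasurable u volume ∧
    ∀ ε : ℝ≥0∞, 0 < ε → ∃ U : Set (EuclideanSpace ℝ (Fin N)),
      IsOpen U ∧ capOpen p U < ε ∧ ContinuousOn u Uᶜ}

/-- The `J_p`-property of a compact set `K`, formulated with quasicontinuous functions. -/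
def JProperty {N : ℕ} (p : ℝ) (K : Set (EuclideanSpace ℝ (Fin N))) : Prop :=
  quasicontinuous N p ∩ sobolev p Kᶜ = quasicontinuous N p ∩ sobolev p univ

/-- The `J_p(cont)`-property of a compact set `K`, formulated with continuous functions. -/
def JPropertyCont {N : ℕ} (p : ℝ) (K : Set (EuclideanSpace ℝ (Fin N))) : Prop :=
  {u | Continuous u} ∩ sobolev p Kᶜ = {u | Continuous u} ∩ sobolev p univ

/-- Lebesgue measure on the hyperplane `v^⊥`. A line parallel to `v ≠ 0` is identified with
its unique point in `v^⊥`, so this is the `(N-1)`-dimensional measure on these lines. -/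
def lineMeasure {N : ℕ} (v : EuclideanSpace ℝ (Fin N)) :
    Measure ((Submodule.span ℝ {v})ᗮ : Submodule ℝ (EuclideanSpace ℝ (Fin N))) :=
  (stdOrthonormalBasis ℝ
    ((Submodule.span ℝ {v})ᗮ : Submodule ℝ (EuclideanSpace ℝ (Fin N)))).toBasis.addHaar

/-- The line through `y` with direction `v`. -/
def lineThrough {N : ℕ} (y v : EuclideanSpace ℝ (Fin N)) : Set (EuclideanSpace ℝ (Fin N)) :=
  {x | ∃ t : ℝ, x = y + t • v}

/-- A singular function on the line: continuous, not constant, with derivative zero at almost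
every point. -/
def IsSingularFunction (f : ℝ → ℝ) : Prop :=
  Continuous f ∧ (∃ a b, f a ≠ f b) ∧ ∀ᵐ t : ℝ, HasDerivAt f 0 t

/-- The support of a singular function, i.e. the support of its distributional derivative:
the set of points that have no neighbourhood on which `f` is constant. -/
def singularSupport (f : ℝ → ℝ) : Set ℝ :=
  {t | ¬ ∀ᶠ s in 𝓝 t, f s = f t}

end SobolevRemovability

end

/-!
A continuous function that is locally constant off a countable set has countable range, hence is
constant; so a singular function has uncountable support.

Let `u` be a Sobolev function off `K` with weak derivative `g` in the direction `v`. By Fubini, on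
almost every line parallel to `v` the restriction of `u` minus a primitive of `g` has zero weak
derivative off `K`, so it is locally constant there. If `u` is continuous on the line and the line
meets `K` in a countable set, the difference is constant, and the weak derivative `g` extends
across `K`. Quasicontinuous functions are continuous on almost every line parallel to an axis: for
a test function `φ ≥ 1` on a set, the norm of `|φ| + |D_j φ|` in `L^p` on each line meeting the
set is at least one, so the projection of an open set `U` along an axis has measure at most
`C_{1,p}(U) ^ p`.
-/

namespace SobolevRemovability

theorem eq_of_eventually_eq_off_countable {X Y : Type*} [TopologicalSpace X] [PreconnectedSpace X]
    [TopologicalSpace.SeparableSpace X] [MetricSpace Y] {f : X → Y} (hf : Continuous f) {S : Set X}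
    (hS : S.Countable) (h : ∀ x ∉ S, ∀ᶠ s in 𝓝 x, f s = f x) (a b : X) : f a = f b := by
  obtain ⟨Q, hQ, hQd⟩ := TopologicalSpace.exists_countable_dense X
  have hrange : (range f).Countable := by
    refine ((hS.image f).union (hQ.image f)).mono ?_
    rintro _ ⟨x, rfl⟩
    by_cases hx : x ∈ S
    · exact Or.inl (mem_image_of_mem f hx)
    · obtain ⟨q, hqx, hq⟩ := hQd.inter_nhds_nonempty (h x hx)
      exact Or.inr ⟨q, hqx, hq⟩
  exact hrange.isTotallyDisconnected _ Subset.rfl (isPreconnected_range hf)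
    (mem_range_self a) (mem_range_self b)

theorem not_countable_singularSupport {f : ℝ → ℝ} (hf : Continuous f) (hne : ∃ a b, f a ≠ f b) :
    ¬ (singularSupport f).Countable := by
  intro hcount
  obtain ⟨a, b, hab⟩ := hne
  exact hab (eq_of_eventually_eq_off_countable hf hcount (fun _ => not_not.1) a b)

theorem integral_primitive_mul_deriv {g : ℝ → ℝ} (hg : LocallyIntegrable g) (a : ℝ) {ψ : ℝ → ℝ}
    (hψ : ContDiff ℝ 1 ψ) (hψc : HasCompactSupport ψ) :
    ∫ t, (∫ s in a..t, g s) * deriv ψ t = -∫ t, g t * ψ t := by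
  obtain ⟨r, hr, hsub⟩ := hψc.isCompact.isBounded.subset_ball_lt 0 a
  rw [Real.ball_eq_Ioo] at hsub
  have hgr : IntervalIntegrable g volume (a - r) (a + r) :=
    (hg.integrableOn_isCompact isCompact_uIcc).intervalIntegrable
  have hprim : AbsolutelyContinuousOnInterval (fun t => ∫ s in a..t, g s) (a - r) (a + r) :=
    hgr.absolutelyContinuousOnInterval_intervalIntegral
      (by rw [uIcc_of_le (by linarith)]; constructor <;> linarith)
  have hψac : AbsolutelyContinuousOnInterval ψ (a - r) (a + r) := by
    obtain ⟨L, hL⟩ := hψ.lipschitzWith_of_hasCompactSupport hψc one_ne_zero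
    exact hL.lipschitzOnWith.absolutelyContinuousOnInterval
  have hderiv : ∀ᵐ t, deriv (fun t => ∫ s in a..t, g s) t = g t := by
    filter_upwards [LocallyIntegrable.ae_hasDerivAt_integral hg] with t ht using (ht a).deriv
  have hsupp : ∀ {w : ℝ → ℝ} (f : ℝ → ℝ), Function.support w ⊆ tsupport ψ →
      ∫ t in (a - r)..(a + r), f t * w t = ∫ t, f t * w t := fun f hw =>
    intervalIntegral.integral_eq_integral_of_support_subset <|
      (Function.support_mul_subset_right f _).trans (hw.trans (hsub.trans Ioo_subset_Ioc_self))
  calc ∫ t, (∫ s in a..t, g s) * deriv ψ t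
      = ∫ t in (a - r)..(a + r), (∫ s in a..t, g s) * deriv ψ t :=
        (hsupp _ (subset_closure.trans tsupport_deriv_subset)).symm
    _ = -∫ t in (a - r)..(a + r), deriv (fun t => ∫ s in a..t, g s) t * ψ t := by
        rw [hprim.integral_mul_deriv_eq_deriv_mul hψac,
          image_eq_zero_of_notMem_tsupport fun h => (hsub h).2.false,
          image_eq_zero_of_notMem_tsupport fun h => (hsub h).1.false]
        ring
    _ = -∫ t in (a - r)..(a + r), g t * ψ t := by
        congr 1
        refine intervalIntegral.integral_congr_ae ?_
        filter_upwards [hderiv] with t ht _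
        rw [ht]
    _ = -∫ t, g t * ψ t := by rw [hsupp _ subset_closure]

/-- A sequence of smooth bumps at the origin of the line whose supports shrink to a point. -/
noncomputable def shrinkingBump (n : ℕ) : ContDiffBump (0 : ℝ) where
  rIn := 1 / (n + 2)
  rOut := 1 / (n + 1)
  rIn_pos := by positivity
  rIn_lt_rOut := by gcongr; norm_num

/-- The smooth bump of integral one supported in the ball of radius `1 / (n + 1)` about `q`, as a
function of `s`. The sign of `q - s` makes integration against it a convolution. -/
noncomputable def mollifier (n : ℕ) (q s : ℝ) : ℝ :=
  (shrinkingBump n).normed volume (q - s)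

theorem contDiff_mollifier (n : ℕ) (q : ℝ) : ContDiff ℝ ∞ (mollifier n q) :=
  (shrinkingBump n).contDiff_normed.comp (contDiff_const.sub contDiff_id)

theorem tsupport_mollifier (n : ℕ) (q : ℝ) :
    tsupport (mollifier n q) = Metric.closedBall q (1 / (n + 1)) := by
  have h := tsupport_comp_eq_preimage ((shrinkingBump n).normed volume) (Homeomorph.subLeft q)
  rw [(shrinkingBump n).tsupport_normed_eq] at h
  refine h.trans ?_
  ext s
  simp [shrinkingBump, Real.dist_eq, abs_sub_comm]

theorem hasCompactSupport_mollifier (n : ℕ) (q : ℝ) : HasCompactSupport (mollifier n q) := by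
  rw [HasCompactSupport, tsupport_mollifier]
  exact isCompact_closedBall _ _

theorem deriv_mollifier (n : ℕ) (q s : ℝ) :
    deriv (mollifier n q) s = -deriv ((shrinkingBump n).normed volume) (q - s) :=
  deriv_comp_const_sub _ _ _

-- Each test function costs a null set of lines, so countably many have to suffice: hence the
-- rational centres.
open scoped Convolution in
theorem eventually_eq_of_integral_mul_deriv_mollifier {F : ℝ → ℝ} (hF : Continuous F) {U : Set ℝ}
    (hU : IsOpen U) (h : ∀ (n : ℕ) (q : ℚ), tsupport (mollifier n q) ⊆ U →
      ∫ s, F s * deriv (mollifier n q) s = 0) {t : ℝ} (ht : t ∈ U) :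
    ∀ᶠ s in 𝓝 t, F s = F t := by
  obtain ⟨ε, hε, hεU⟩ := Metric.isOpen_iff.1 hU t ht
  set ρ : ℕ → ℝ → ℝ := fun n => (shrinkingBump n).normed volume with hρ
  have hρc (n : ℕ) : HasCompactSupport (ρ n) := (shrinkingBump n).hasCompactSupport_normed
  have hρd (n : ℕ) : ContDiff ℝ 1 (ρ n) := (shrinkingBump n).contDiff_normed
  have hconv (n : ℕ) (x : ℝ) : HasDerivAt (ρ n ⋆[ContinuousLinearMap.lsmul ℝ ℝ] F)
      ((deriv (ρ n) ⋆[ContinuousLinearMap.lsmul ℝ ℝ] F) x) x :=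
    (hρc n).hasDerivAt_convolution_left _ (hρd n) hF.locallyIntegrable x
  have hrOut : Tendsto (fun n => (shrinkingBump n).rOut) atTop (𝓝 0) :=
    tendsto_one_div_add_atTop_nhds_zero_nat
  have hlim (x : ℝ) := ContDiffBump.convolution_tendsto_right_of_continuous (μ := volume)
    hrOut hF x
  have hderiv : ∀ᶠ n in atTop, ∀ x ∈ Metric.ball t (ε / 2),
      (deriv (ρ n) ⋆[ContinuousLinearMap.lsmul ℝ ℝ] F) x = 0 := by
    filter_upwards [hrOut.eventually_lt_const (half_pos hε)] with n hn x hx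
    have hcont : Continuous (deriv (ρ n) ⋆[ContinuousLinearMap.lsmul ℝ ℝ] F) :=
      (hρc n).deriv.continuous_convolution_left _ ((hρd n).continuous_deriv le_rfl)
        hF.locallyIntegrable
    refine closure_minimal (fun _ hy => ?_) (isClosed_eq hcont continuous_const)
      (Rat.denseRange_cast.open_subset_closure_inter Metric.isOpen_ball hx)
    obtain ⟨hy, q, rfl⟩ := hy
    have hsub : tsupport (mollifier n q) ⊆ U := by
      rw [tsupport_mollifier]
      refine (Metric.closedBall_subset_ball' ?_).trans hεU
      change 1 / ((n : ℝ) + 1) < ε / 2 at hn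
      linarith [Metric.mem_ball.1 hy]
    have hq := h n q hsub
    simp only [deriv_mollifier, mul_neg, integral_neg, neg_eq_zero] at hq
    rw [mem_ofPred_eq, convolution_eq_swap, ← hq]
    simp only [ContinuousLinearMap.lsmul_apply, smul_eq_mul, mul_comm, hρ]
  filter_upwards [Metric.ball_mem_nhds t (half_pos hε)] with s hs
  refine tendsto_nhds_unique_of_eventuallyEq (hlim s) (hlim t) ?_
  filter_upwards [hderiv] with n hn
  exact Metric.isOpen_ball.is_const_of_deriv_eq_zero (convex_ball t (ε / 2)).isPreconnected
    (fun x _ => (hconv n x).differentiableAt.differentiableWithinAt)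
    (fun x hx => (hconv n x).deriv.trans (hn x hx)) hs (Metric.mem_ball_self (half_pos hε))

theorem integrable_mul_of_hasCompactSupport {E : Type*} [TopologicalSpace E] [T2Space E]
    [MeasurableSpace E] [OpensMeasurableSpace E] {μ : Measure E} {u w : E → ℝ}
    (hu : LocallyIntegrable u μ) (hw : Continuous w) (hwc : HasCompactSupport w) :
    Integrable (fun x => u x * w x) μ :=
  hu.integrable_smul_right_of_hasCompactSupport hw hwc

theorem integral_mul_deriv_of_countable_compl {u g : ℝ → ℝ} (hu : Continuous u)
    (hg : LocallyIntegrable g) {U : Set ℝ} (hU : IsOpen U) (hUc : Uᶜ.Countable)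
    (h : ∀ (n : ℕ) (q : ℚ), tsupport (mollifier n q) ⊆ U →
      ∫ s, u s * deriv (mollifier n q) s = -∫ s, g s * mollifier n q s)
    {ψ : ℝ → ℝ} (hψ : ContDiff ℝ 1 ψ) (hψc : HasCompactSupport ψ) :
    ∫ t, u t * deriv ψ t = -∫ t, g t * ψ t := by
  set P : ℝ → ℝ := fun t => ∫ s in (0 : ℝ)..t, g s
  have hP : Continuous P := intervalIntegral.continuous_primitive
    (fun _ _ => (hg.integrableOn_isCompact isCompact_uIcc).intervalIntegrable) 0
  have hsub {ψ : ℝ → ℝ} (hψ : ContDiff ℝ 1 ψ) (hψc : HasCompactSupport ψ) :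
      ∫ t, (u t - P t) * deriv ψ t = (∫ t, u t * deriv ψ t) + ∫ t, g t * ψ t := by
    have hint {f : ℝ → ℝ} (hf : Continuous f) := integrable_mul_of_hasCompactSupport
      (μ := volume) hf.locallyIntegrable (hψ.continuous_deriv le_rfl) hψc.deriv
    simp only [sub_mul]
    rw [integral_sub (hint hu) (hint hP), integral_primitive_mul_deriv hg 0 hψ hψc, sub_neg_eq_add]
  have hloc : ∀ t ∉ Uᶜ, ∀ᶠ s in 𝓝 t, u s - P s = u t - P t := fun t ht =>
    eventually_eq_of_integral_mul_deriv_mollifier (F := fun t => u t - P t) (hu.sub hP) hU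
      (fun n q hq => by
        rw [hsub ((contDiff_mollifier n q).of_le (by simp)) (hasCompactSupport_mollifier n q),
          h n q hq, neg_add_cancel]) (not_not.1 ht)
  have hconst (t : ℝ) : u t - P t = u 0 - P 0 :=
    eq_of_eventually_eq_off_countable (hu.sub hP) hUc hloc t 0
  have hψ0 : ∫ t, deriv ψ t = 0 := integral_eq_zero_of_hasDerivAt_of_integrable
    (fun t => (hψ.differentiable one_ne_zero t).hasDerivAt)
    ((hψ.continuous_deriv le_rfl).integrable_of_hasCompactSupport hψc.deriv)
    (hψ.continuous.integrable_of_hasCompactSupport hψc)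
  rw [← add_eq_zero_iff_eq_neg, ← hsub hψ hψc]
  simp only [hconst, integral_const_mul, hψ0, mul_zero]

section FullOuterMeasure

-- The set `D` of lines with a countable section is not visibly measurable; `μ.restrict D = μ` says
-- that it has full outer measure.

variable {α : Type*} [MeasurableSpace α] {μ : Measure α} {D : Set α}

theorem restrict_eq_self_of_forall_exists_mem [SFinite μ]
    (h : ∀ A, MeasurableSet A → 0 < μ A → ∃ y ∈ A, y ∈ D) : μ.restrict D = μ := by
  have hnull : μ (toMeasurable μ D)ᶜ = 0 := by
    by_contra hne
    obtain ⟨y, hy, hyD⟩ := h _ (measurableSet_toMeasurable μ D).compl (pos_iff_ne_zero.2 hne)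
    exact hy (subset_toMeasurable μ D hyD)
  rw [← Measure.restrict_toMeasurable_of_sFinite]
  exact Measure.restrict_eq_self_of_ae_mem (mem_ae_iff.2 hnull)

theorem ae_of_restrict_eq_self (hD : μ.restrict D = μ) {p : α → Prop}
    (hp : NullMeasurableSet {x | p x} μ) (h : ∀ᵐ x ∂μ, x ∈ D → p x) : ∀ᵐ x ∂μ, p x := by
  rw [← hD] at hp ⊢
  exact (ae_restrict_iff₀ hp).2 h

theorem prod_eq_zero_of_countable_slices (hD : μ.restrict D = μ) {S : Set (α × ℝ)}
    (hS : MeasurableSet S) (hcount : ∀ y ∈ D, {t | (y, t) ∈ S}.Countable) :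
    μ.prod volume S = 0 := by
  rw [Measure.measure_prod_null hS]
  refine ae_of_restrict_eq_self hD ?_ (.of_forall fun y hy => (hcount y hy).measure_zero _)
  exact (measurable_measure_prodMk_left hS (measurableSet_singleton 0)).nullMeasurableSet

end FullOuterMeasure

section WeakLineDeriv

theorem deriv_comp_add_smul {E : Type*} [NormedAddCommGroup E] [NormedSpace ℝ E] {φ : E → ℝ}
    (hφ : Differentiable ℝ φ) (x v : E) (t : ℝ) :
    deriv (fun s : ℝ => φ (x + s • v)) t = fderiv ℝ φ (x + t • v) v := by
  have hline : HasDerivAt (fun s : ℝ => x + s • v) v t := by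
    simpa using ((hasDerivAt_id t).smul_const v).const_add x
  exact ((hφ _).hasFDerivAt.comp_hasDerivAt t hline).deriv

theorem fderiv_apply_zero_one {E : Type*} [NormedAddCommGroup E] [NormedSpace ℝ E]
    {φ : E × ℝ → ℝ} (hφ : Differentiable ℝ φ) (y : E) (t : ℝ) :
    fderiv ℝ φ (y, t) (0, 1) = deriv (fun s => φ (y, s)) t := by
  simpa using (deriv_comp_add_smul hφ (y, 0) (0, 1) t).symm

variable {E F : Type*} [NormedAddCommGroup E] [NormedSpace ℝ E] [MeasurableSpace E]
  [NormedAddCommGroup F] [NormedSpace ℝ F] [MeasurableSpace F]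
  {μ : Measure E} {ν : Measure F}

/-- `g` is the weak derivative of `u` in the direction `v` on the open set `Ω`. Test functions and
their derivatives vanish off `Ω`, so the integrals may run over the whole space. -/
def IsWeakLineDeriv (μ : Measure E) (Ω : Set E) (v : E) (u g : E → ℝ) : Prop :=
  ∀ φ : E → ℝ, ContDiff ℝ ∞ φ → HasCompactSupport φ → tsupport φ ⊆ Ω →
    ∫ x, u x * fderiv ℝ φ x v ∂μ = -∫ x, g x * φ x ∂μ

theorem IsWeakLineDeriv.mono {Ω Ω' : Set E} {v : E} {u g : E → ℝ}
    (h : IsWeakLineDeriv μ Ω' v u g) (hΩ : Ω ⊆ Ω') : IsWeakLineDeriv μ Ω v u g :=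
  fun φ hφ hφc hφΩ => h φ hφ hφc (hφΩ.trans hΩ)

theorem IsWeakLineDeriv.comp_continuousLinearEquiv [BorelSpace E] [BorelSpace F] {Ω : Set F}
    {u g : F → ℝ} {T : E ≃L[ℝ] F} (hT : MeasurePreserving T μ ν) {v : E}
    (h : IsWeakLineDeriv ν Ω (T v) u g) :
    IsWeakLineDeriv μ (T ⁻¹' Ω) v (u ∘ T) (g ∘ T) := by
  intro φ hφ hφc hφΩ
  have hTe : MeasurableEmbedding T := T.toHomeomorph.measurableEmbedding
  have hsupp : tsupport (φ ∘ T.symm) ⊆ Ω := by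
    refine (tsupport_comp_eq_preimage φ T.symm.toHomeomorph).trans_subset fun x hx => ?_
    simpa using hφΩ hx
  have hint := h (φ ∘ T.symm) (hφ.comp T.symm.contDiff)
    (hφc.comp_homeomorph T.symm.toHomeomorph) hsupp
  rw [← hT.integral_comp hTe, ← hT.integral_comp hTe] at hint
  simpa [ContinuousLinearEquiv.comp_right_fderiv] using hint

theorem isWeakPartialDeriv_iff {N : ℕ} {Ω : Set (EuclideanSpace ℝ (Fin N))} {j : Fin N}
    {u g : EuclideanSpace ℝ (Fin N) → ℝ} :
    IsWeakPartialDeriv Ω j u g ↔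
      IsWeakLineDeriv volume Ω (EuclideanSpace.single j 1) u g := by
  refine forall₄_congr fun φ _ _ hφΩ => ?_
  rw [setIntegral_eq_integral_of_forall_compl_eq_zero fun x hx => ?_,
    setIntegral_eq_integral_of_forall_compl_eq_zero fun x hx => ?_]
  · rfl
  · rw [image_eq_zero_of_notMem_tsupport fun h => hx (hφΩ h), mul_zero]
  · rw [partialDeriv, image_eq_zero_of_notMem_tsupport (f := fderiv ℝ φ) fun h =>
      hx (hφΩ (tsupport_fderiv_subset ℝ h)), zero_apply, mul_zero]

theorem sobolev_anti {N : ℕ} {p : ℝ} {Ω Ω' : Set (EuclideanSpace ℝ (Fin N))} (hΩ : Ω ⊆ Ω') :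
    sobolev p Ω' ⊆ sobolev p Ω := by
  rintro u ⟨hu, hg⟩
  refine ⟨hu.mono_measure (Measure.restrict_mono_set _ hΩ), fun j => ?_⟩
  obtain ⟨g, hg, hw⟩ := hg j
  exact ⟨g, hg.mono_measure (Measure.restrict_mono_set _ hΩ),
    isWeakPartialDeriv_iff.2 ((isWeakPartialDeriv_iff.1 hw).mono hΩ)⟩

end WeakLineDeriv

section Slicing

variable {W : Type*} [NormedAddCommGroup W] [MeasurableSpace W] {μ : Measure W}

theorem integrable_fst_mul [BorelSpace W] {H : W × ℝ → ℝ}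
    (hH : LocallyIntegrable H (μ.prod volume)) {k : Set ℝ} (hk : IsCompact k)
    (hHk : ∀ z, z.2 ∉ k → H z = 0) {χ : W → ℝ} (hχ : Continuous χ) (hχc : HasCompactSupport χ) :
    Integrable (fun z : W × ℝ => χ z.1 * H z) (μ.prod volume) := by
  have hK : IsCompact (tsupport χ ×ˢ k) := hχc.isCompact.prod hk
  have hχ' : Continuous fun z : W × ℝ => χ z.1 := hχ.comp continuous_fst
  refine ((hH.integrableOn_isCompact hK).continuousOn_mul hχ'.continuousOn hK
    ).integrable_of_forall_notMem_eq_zero fun z hz => ?_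
  rcases not_and_or.1 hz with hz | hz
  · rw [image_eq_zero_of_notMem_tsupport hz, zero_mul]
  · rw [hHk z hz, mul_zero]

variable [NormedSpace ℝ W]

theorem IsWeakLineDeriv.integral_tensor {Ω : Set (W × ℝ)} {u g : W × ℝ → ℝ}
    (h : IsWeakLineDeriv (μ.prod volume) Ω (0, 1) u g) {χ : W → ℝ} (hχ : ContDiff ℝ ∞ χ)
    (hχc : HasCompactSupport χ) {ψ : ℝ → ℝ} (hψ : ContDiff ℝ ∞ ψ) (hψc : HasCompactSupport ψ)
    (hΩ : tsupport χ ×ˢ tsupport ψ ⊆ Ω) :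
    ∫ z, χ z.1 * (u z * deriv ψ z.2) ∂μ.prod volume =
      -∫ z, χ z.1 * (g z * ψ z.2) ∂μ.prod volume := by
  have hφ : ContDiff ℝ ∞ fun z : W × ℝ => χ z.1 * ψ z.2 :=
    (hχ.comp contDiff_fst).mul (hψ.comp contDiff_snd)
  have hsupp : tsupport (fun z : W × ℝ => χ z.1 * ψ z.2) ⊆ tsupport χ ×ˢ tsupport ψ :=
    closure_minimal (fun z hz => ⟨subset_tsupport _ (left_ne_zero_of_mul hz),
      subset_tsupport _ (right_ne_zero_of_mul hz)⟩)
      ((isClosed_tsupport χ).prod (isClosed_tsupport ψ))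
  have hderiv (z : W × ℝ) :
      fderiv ℝ (fun z : W × ℝ => χ z.1 * ψ z.2) z (0, 1) = χ z.1 * deriv ψ z.2 := by
    rw [fderiv_apply_zero_one (hφ.differentiable (by simp)) z.1 z.2]
    exact deriv_const_mul_field (χ z.1)
  have hint := h _ hφ ((hχc.isCompact.prod hψc.isCompact).of_isClosed_subset
    (isClosed_tsupport _) hsupp) (hsupp.trans hΩ)
  simpa only [hderiv, mul_left_comm] using hint

variable [FiniteDimensional ℝ W] [IsLocallyFiniteMeasure μ]

theorem locallyIntegrable_integral_slice {H : W × ℝ → ℝ}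
    (hH : LocallyIntegrable H (μ.prod volume)) {k : Set ℝ} (hk : IsCompact k)
    (hHk : ∀ z, z.2 ∉ k → H z = 0) : LocallyIntegrable (fun y => ∫ t, H (y, t)) μ := by
  refine locallyIntegrable_iff.2 fun C hC => ?_
  have hint := hH.integrableOn_isCompact (hC.prod hk)
  rw [IntegrableOn, ← Measure.prod_restrict] at hint
  refine hint.integral_prod_left.congr (.of_forall fun y => ?_)
  exact setIntegral_eq_integral_of_forall_compl_eq_zero fun t ht => hHk (y, t) ht

variable [BorelSpace W]

theorem ae_locallyIntegrable_slice {g : W × ℝ → ℝ} (hg : LocallyIntegrable g (μ.prod volume)) :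
    ∀ᵐ y ∂μ, LocallyIntegrable fun t => g (y, t) := by
  have hcompact (m n : ℕ) : ∀ᵐ y ∂μ, y ∈ compactCovering W m →
      IntegrableOn (fun t => g (y, t)) (Metric.closedBall 0 n) := by
    have hint := hg.integrableOn_isCompact
      ((isCompact_compactCovering W m).prod (isCompact_closedBall (0 : ℝ) n))
    rw [IntegrableOn, ← Measure.prod_restrict] at hint
    exact (ae_restrict_iff' (isCompact_compactCovering W m).measurableSet).1 hint.prod_right_ae
  filter_upwards [ae_all_iff.2 fun m => ae_all_iff.2 (hcompact m)] with y hy t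
  obtain ⟨m, hm⟩ := mem_iUnion.1 ((iUnion_compactCovering W).symm ▸ mem_univ y)
  obtain ⟨n, hn⟩ := exists_nat_gt (dist t 0)
  exact ⟨_, Metric.closedBall_mem_nhds_of_mem hn, hy m n hm⟩

theorem ae_integral_slice_eq_zero {H : W × ℝ → ℝ} (hH : LocallyIntegrable H (μ.prod volume))
    {k : Set ℝ} (hk : IsCompact k) (hHk : ∀ z, z.2 ∉ k → H z = 0) {V : Set W} (hV : IsOpen V)
    (h : ∀ χ : W → ℝ, ContDiff ℝ ∞ χ → HasCompactSupport χ → tsupport χ ⊆ V →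
      ∫ z : W × ℝ, χ z.1 * H z ∂μ.prod volume = 0) :
    ∀ᵐ y ∂μ, y ∈ V → ∫ t, H (y, t) = 0 := by
  refine hV.ae_eq_zero_of_integral_contDiff_smul_eq_zero
    ((locallyIntegrable_integral_slice hH hk hHk).locallyIntegrableOn V) fun χ hχ hχc hχV => ?_
  rw [← h χ hχ hχc hχV, integral_prod _ (integrable_fst_mul hH hk hHk hχ.continuous hχc)]
  simp only [smul_eq_mul, integral_const_mul]

theorem IsWeakLineDeriv.ae_slice {Ω : Set (W × ℝ)} (hΩ : IsOpen Ω) {u g : W × ℝ → ℝ}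
    (hu : LocallyIntegrable u (μ.prod volume)) (hg : LocallyIntegrable g (μ.prod volume))
    (h : IsWeakLineDeriv (μ.prod volume) Ω (0, 1) u g) {ψ : ℝ → ℝ} (hψ : ContDiff ℝ ∞ ψ)
    (hψc : HasCompactSupport ψ) :
    ∀ᵐ y ∂μ, (∀ t ∈ tsupport ψ, (y, t) ∈ Ω) →
      ∫ t, u (y, t) * deriv ψ t = -∫ t, g (y, t) * ψ t := by
  have hψ' : Continuous (deriv ψ) := hψ.continuous_deriv (by simp)
  have hV : IsOpen {y | ∀ t ∈ tsupport ψ, (y, t) ∈ Ω} := isOpen_iff_mem_nhds.2 fun y hy =>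
    hψc.isCompact.eventually_forall_of_forall_eventually fun t ht => hΩ.mem_nhds (hy t ht)
  have hu' : LocallyIntegrable (fun z : W × ℝ => u z * deriv ψ z.2) (μ.prod volume) :=
    hu.mul_continuous (hψ'.comp continuous_snd)
  have hg' : LocallyIntegrable (fun z : W × ℝ => g z * ψ z.2) (μ.prod volume) :=
    hg.mul_continuous (hψ.continuous.comp continuous_snd)
  have hu0 : ∀ z : W × ℝ, z.2 ∉ tsupport ψ → u z * deriv ψ z.2 = 0 := fun z hz => by
    rw [image_eq_zero_of_notMem_tsupport fun hz' => hz (tsupport_deriv_subset hz'), mul_zero]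
  have hg0 : ∀ z : W × ℝ, z.2 ∉ tsupport ψ → g z * ψ z.2 = 0 := fun z hz => by
    rw [image_eq_zero_of_notMem_tsupport hz, mul_zero]
  have hzero := ae_integral_slice_eq_zero (hu'.add hg') hψc.isCompact
    (fun z hz => by rw [Pi.add_apply, hu0 z hz, hg0 z hz, add_zero]) hV fun χ hχ hχc hχV => by
      simp only [Pi.add_apply, mul_add]
      rw [integral_add (integrable_fst_mul hu' hψc.isCompact hu0 hχ.continuous hχc)
        (integrable_fst_mul hg' hψc.isCompact hg0 hχ.continuous hχc),
        h.integral_tensor hχ hχc hψ hψc fun z hz => hχV hz.1 _ hz.2, neg_add_cancel]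
  filter_upwards [hzero, ae_locallyIntegrable_slice hu, ae_locallyIntegrable_slice hg]
    with y hy huy hgy hyV
  rw [← add_eq_zero_iff_eq_neg, ← hy hyV]
  exact (integral_add (integrable_mul_of_hasCompactSupport huy hψ' hψc.deriv)
    (integrable_mul_of_hasCompactSupport hgy hψ.continuous hψc)).symm

theorem IsWeakLineDeriv.ae_slice_of_countable {Ω : Set (W × ℝ)} (hΩ : IsOpen Ω)
    {u g : W × ℝ → ℝ} (hu : LocallyIntegrable u (μ.prod volume))
    (hg : LocallyIntegrable g (μ.prod volume)) (huc : ∀ᵐ y ∂μ, Continuous fun t => u (y, t))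
    (h : IsWeakLineDeriv (μ.prod volume) Ω (0, 1) u g) :
    ∀ᵐ y ∂μ, {t | (y, t) ∉ Ω}.Countable → ∀ ψ : ℝ → ℝ, ContDiff ℝ 1 ψ → HasCompactSupport ψ →
      ∫ t, u (y, t) * deriv ψ t = -∫ t, g (y, t) * ψ t := by
  have hmollifier : ∀ᵐ y ∂μ, ∀ (n : ℕ) (q : ℚ), tsupport (mollifier n q) ⊆ {t | (y, t) ∈ Ω} →
      ∫ t, u (y, t) * deriv (mollifier n q) t = -∫ t, g (y, t) * mollifier n q t :=
    ae_all_iff.2 fun n => ae_all_iff.2 fun q =>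
      h.ae_slice hΩ hu hg (contDiff_mollifier n q) (hasCompactSupport_mollifier n q)
  filter_upwards [hmollifier, huc, ae_locallyIntegrable_slice hg] with y hy huy hgy hcount ψ hψ hψc
  exact integral_mul_deriv_of_countable_compl huy hgy
    (hΩ.preimage (Continuous.prodMk_right y)) hcount hy hψ hψc

theorem IsWeakLineDeriv.univ_of_countable_slices {D : Set W} (hD : μ.restrict D = μ)
    {Ω : Set (W × ℝ)} (hΩ : IsOpen Ω) (hcount : ∀ y ∈ D, {t | (y, t) ∉ Ω}.Countable)
    {u g : W × ℝ → ℝ} (hu : LocallyIntegrable u (μ.prod volume))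
    (hg : LocallyIntegrable g (μ.prod volume)) (huc : ∀ᵐ y ∂μ, Continuous fun t => u (y, t))
    (h : IsWeakLineDeriv (μ.prod volume) Ω (0, 1) u g) :
    IsWeakLineDeriv (μ.prod volume) univ (0, 1) u g := by
  intro φ hφ hφc _
  have hintu : Integrable (fun z => u z * fderiv ℝ φ z (0, 1)) (μ.prod volume) :=
    integrable_mul_of_hasCompactSupport hu
      ((hφ.continuous_fderiv (by simp)).clm_apply continuous_const) (hφc.fderiv_apply ℝ (0, 1))
  have hintg : Integrable (fun z => g z * φ z) (μ.prod volume) :=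
    integrable_mul_of_hasCompactSupport hg hφ.continuous hφc
  have hmeas : NullMeasurableSet {y | ∫ t, u (y, t) * fderiv ℝ φ (y, t) (0, 1) =
      -∫ t, g (y, t) * φ (y, t)} μ :=
    nullMeasurableSet_eq_fun hintu.integral_prod_left.aestronglyMeasurable.aemeasurable
      hintg.integral_prod_left.neg.aestronglyMeasurable.aemeasurable
  rw [integral_prod _ hintu, integral_prod _ hintg, ← integral_neg]
  refine integral_congr_ae (ae_of_restrict_eq_self hD hmeas ?_)
  filter_upwards [h.ae_slice_of_countable hΩ hu hg huc] with y hy hyD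
  simp only [fderiv_apply_zero_one (hφ.differentiable (by simp))]
  refine hy (hcount y hyD) _ (hφ.of_le (by simp) |>.comp (contDiff_prodMk_right y)) ?_
  exact hφc.comp_isClosedEmbedding (Function.LeftInverse.isClosedEmbedding (f := Prod.snd)
    (fun _ => rfl) continuous_snd (Continuous.prodMk_right y))

end Slicing

section Lines

variable {E : Type*} [NormedAddCommGroup E] [InnerProductSpace ℝ E] {v : E}

/-- The coordinates `(y, t) ↦ y + t v` adapted to the lines parallel to a unit vector `v`. -/
noncomputable def lineEquiv (v : E) (hv : ‖v‖ = 1) : ((ℝ ∙ v)ᗮ × ℝ) ≃L[ℝ] E :=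
  (ContinuousLinearEquiv.prodComm ℝ _ ℝ).trans <|
    (WithLp.prodContinuousLinearEquiv 2 ℝ ℝ _).symm.trans <|
      ((LinearIsometryEquiv.withLpProdCongr 2 (LinearIsometryEquiv.toSpanUnitSingleton v hv)
        (LinearIsometryEquiv.refl ℝ (ℝ ∙ v)ᗮ)).trans
          (ℝ ∙ v).orthogonalDecomposition.symm).toContinuousLinearEquiv

theorem lineEquiv_apply (hv : ‖v‖ = 1) (z : (ℝ ∙ v)ᗮ × ℝ) :
    lineEquiv v hv z = (z.1 : E) + z.2 • v := by
  simp [lineEquiv, add_comm]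

/-- The lines with direction `v`, represented by their points in `vᗮ`, that meet `S` in a countable
set. -/
def countableLines (v : E) (S : Set E) : Set (ℝ ∙ v)ᗮ :=
  {y | {t : ℝ | (y : E) + t • v ∈ S}.Countable}

/-- The lines with direction `v`, represented by their points in `vᗮ`, that meet `S`: the
orthogonal projection of `S` along `v`. -/
def shadow (v : E) (S : Set E) : Set (ℝ ∙ v)ᗮ :=
  {y | ∃ t : ℝ, (y : E) + t • v ∈ S}

variable [FiniteDimensional ℝ E] [MeasurableSpace E] [BorelSpace E]

theorem measurePreserving_lineEquiv (hv : ‖v‖ = 1) :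
    MeasurePreserving (lineEquiv v hv) (volume.prod volume) volume :=
  ((LinearIsometryEquiv.withLpProdCongr 2 (LinearIsometryEquiv.toSpanUnitSingleton v hv)
    (LinearIsometryEquiv.refl ℝ (ℝ ∙ v)ᗮ)).trans
      (ℝ ∙ v).orthogonalDecomposition.symm).measurePreserving.comp
    ((WithLp.volume_preserving_toLp ℝ (ℝ ∙ v)ᗮ).comp Measure.measurePreserving_swap)

theorem volume_eq_zero_of_countable_lines (hv : ‖v‖ = 1) {S : Set E} (hS : MeasurableSet S)
    (hD : volume.restrict (countableLines v S) = volume) : volume S = 0 := by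
  rw [← (measurePreserving_lineEquiv hv).measure_preimage hS.nullMeasurableSet]
  refine prod_eq_zero_of_countable_slices hD ((lineEquiv v hv).continuous.measurable hS) ?_
  simp only [mem_preimage, lineEquiv_apply]
  exact fun y hy => hy

theorem IsWeakLineDeriv.univ_of_countable_lines (hv : ‖v‖ = 1) {Ω : Set E} (hΩ : IsOpen Ω)
    (hD : volume.restrict (countableLines v Ωᶜ) = volume) {u g : E → ℝ}
    (hu : LocallyIntegrable u) (hg : LocallyIntegrable g)
    (huc : ∀ᵐ y : (ℝ ∙ v)ᗮ, Continuous fun t : ℝ => u (y + t • v))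
    (h : IsWeakLineDeriv volume Ω v u g) : IsWeakLineDeriv volume univ v u g := by
  set T := lineEquiv v hv with hT
  have hTm : MeasurePreserving T (volume.prod volume) volume := measurePreserving_lineEquiv hv
  have hTv : T (0, 1) = v := by simp [hT, lineEquiv_apply]
  have hloc {f : E → ℝ} (hf : LocallyIntegrable f) :
      LocallyIntegrable (f ∘ T) (volume.prod volume) :=
    (locallyIntegrable_map_homeomorph T.toHomeomorph).1 (hTm.map_eq.symm ▸ hf)
  have hprod : IsWeakLineDeriv (volume.prod volume) univ (0, 1) (u ∘ T) (g ∘ T) :=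
    IsWeakLineDeriv.univ_of_countable_slices hD (hΩ.preimage T.continuous)
      (by simp only [hT, mem_preimage, lineEquiv_apply]; exact fun y hy => hy) (hloc hu) (hloc hg)
      (by simpa only [hT, Function.comp_apply, lineEquiv_apply] using huc)
      (IsWeakLineDeriv.comp_continuousLinearEquiv hTm (by rwa [hTv]))
  have hTs : MeasurePreserving T.symm volume (volume.prod volume) :=
    hTm.symm T.toHomeomorph.toMeasurableEquiv
  have hTsv : T.symm v = (0, 1) := T.symm_apply_eq.2 hTv.symm
  have hback := IsWeakLineDeriv.comp_continuousLinearEquiv hTs (hTsv.symm ▸ hprod)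
  simpa [Function.comp_assoc] using hback

end Lines

section Capacity

theorem enorm_le_setLIntegral_enorm_add_enorm_deriv {F : Type*} [NormedAddCommGroup F]
    [NormedSpace ℝ F] [CompleteSpace F] {f : ℝ → F} (hf : ContDiff ℝ 1 f) (a : ℝ) :
    ‖f a‖ₑ ≤ ∫⁻ t in Ioc a (a + 1), (‖f t‖ₑ + ‖deriv f t‖ₑ) := by
  have hd : Continuous (deriv f) := hf.continuous_deriv le_rfl
  have hosc : ∀ t ∈ Ioc a (a + 1), ‖f a‖ₑ ≤ ‖f t‖ₑ + ∫⁻ s in Ioc a (a + 1), ‖deriv f s‖ₑ := by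
    intro t ht
    have hftc : f t - f a = ∫ s in a..t, deriv f s :=
      (intervalIntegral.integral_deriv_eq_sub (fun x _ => hf.differentiable one_ne_zero x)
        (hd.intervalIntegrable _ _)).symm
    calc ‖f a‖ₑ = ‖f t - (f t - f a)‖ₑ := by rw [sub_sub_cancel]
      _ ≤ ‖f t‖ₑ + ‖f t - f a‖ₑ := enorm_sub_le
      _ ≤ ‖f t‖ₑ + ∫⁻ s in Ioc a (a + 1), ‖deriv f s‖ₑ := by
        rw [hftc, intervalIntegral.integral_of_le ht.1.le]
        gcongr
        exact (enorm_integral_le_lintegral_enorm _).trans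
          (lintegral_mono_set (Ioc_subset_Ioc_right ht.2))
  calc ‖f a‖ₑ = ∫⁻ _ in Ioc a (a + 1), ‖f a‖ₑ := by simp
    _ ≤ ∫⁻ t in Ioc a (a + 1), (‖f t‖ₑ + ∫⁻ s in Ioc a (a + 1), ‖deriv f s‖ₑ) :=
      setLIntegral_mono' measurableSet_Ioc hosc
    _ = ∫⁻ t in Ioc a (a + 1), (‖f t‖ₑ + ‖deriv f t‖ₑ) := by
      rw [lintegral_add_left hf.continuous.enorm.measurable,
        lintegral_add_left hf.continuous.enorm.measurable]
      simp

theorem enorm_rpow_le_lintegral_rpow {F : Type*} [NormedAddCommGroup F] [NormedSpace ℝ F]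
    [CompleteSpace F] {p : ℝ} (hp : 1 ≤ p) {f : ℝ → F} (hf : ContDiff ℝ 1 f) (a : ℝ) :
    ‖f a‖ₑ ^ p ≤ ∫⁻ t, (‖f t‖ₑ + ‖deriv f t‖ₑ) ^ p := by
  have hp0 : 0 < p := by positivity
  have hw : Continuous fun t => ‖f t‖ₑ + ‖deriv f t‖ₑ :=
    hf.continuous.enorm.add (hf.continuous_deriv le_rfl).enorm
  have hprob : IsProbabilityMeasure (volume.restrict (Ioc a (a + 1))) := ⟨by simp⟩
  have hjensen := eLpNorm'_le_eLpNorm'_of_exponent_le one_pos hp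
    (volume.restrict (Ioc a (a + 1))) hw.aestronglyMeasurable
  simp only [eLpNorm', enorm_eq_self, ENNReal.rpow_one, div_one] at hjensen
  calc ‖f a‖ₑ ^ p ≤ ∫⁻ t in Ioc a (a + 1), (‖f t‖ₑ + ‖deriv f t‖ₑ) ^ p := by
        rw [← ENNReal.le_rpow_inv_iff hp0, ← one_div]
        exact (enorm_le_setLIntegral_enorm_add_enorm_deriv hf a).trans hjensen
    _ ≤ ∫⁻ t, (‖f t‖ₑ + ‖deriv f t‖ₑ) ^ p := setLIntegral_le_lintegral _ _

section

variable {E : Type*} [NormedAddCommGroup E] [InnerProductSpace ℝ E] [FiniteDimensional ℝ E]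
  [MeasurableSpace E] [BorelSpace E] {v : E}

theorem volume_shadow_le_lintegral_rpow (hv : ‖v‖ = 1) {p : ℝ} (hp : 1 ≤ p) {φ : E → ℝ}
    (hφ : ContDiff ℝ 1 φ) {S : Set E} (hS : ∀ x ∈ S, 1 ≤ φ x) :
    volume (shadow v S) ≤ ∫⁻ x, (‖φ x‖ₑ + ‖fderiv ℝ φ x v‖ₑ) ^ p := by
  set w : E → ℝ≥0∞ := fun x => (‖φ x‖ₑ + ‖fderiv ℝ φ x v‖ₑ) ^ p
  have hw : Measurable w := (hφ.continuous.enorm.measurable.add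
    ((hφ.continuous_fderiv one_ne_zero).clm_apply continuous_const).enorm.measurable).pow_const p
  have hwT := hw.comp (lineEquiv v hv).continuous.measurable
  have hline : ∀ y ∈ shadow v S, 1 ≤ ∫⁻ t, (w ∘ lineEquiv v hv) (y, t) := by
    rintro y ⟨t, ht⟩
    have hφy : ContDiff ℝ 1 fun s : ℝ => φ (y + s • v) := by fun_prop
    calc (1 : ℝ≥0∞) ≤ ‖φ (y + t • v)‖ₑ ^ p := by
          refine ENNReal.one_le_rpow ?_ (by positivity)
          rw [Real.enorm_eq_ofReal_abs, ENNReal.one_le_ofReal]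
          exact (hS _ ht).trans (le_abs_self _)
      _ ≤ ∫⁻ s, (w ∘ lineEquiv v hv) (y, s) := by
          simpa only [deriv_comp_add_smul (hφ.differentiable one_ne_zero), Function.comp_apply,
            lineEquiv_apply] using enorm_rpow_le_lintegral_rpow hp hφy t
  rw [← (measurePreserving_lineEquiv hv).lintegral_comp hw]
  calc _ ≤ volume {y | 1 ≤ ∫⁻ t, (w ∘ lineEquiv v hv) (y, t)} := measure_mono hline
    _ ≤ ∫⁻ y, ∫⁻ t, (w ∘ lineEquiv v hv) (y, t) := by
      simpa using mul_meas_ge_le_lintegral hwT.lintegral_prod_right' 1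
    _ = ∫⁻ z, (w ∘ lineEquiv v hv) z ∂volume.prod volume := (lintegral_prod _ hwT.aemeasurable).symm

end

variable {N : ℕ} {p : ℝ} (j : Fin N)

theorem volume_shadow_le_capCompact (hp : 1 ≤ p) (F : Set (EuclideanSpace ℝ (Fin N))) :
    volume (shadow (EuclideanSpace.single j (1 : ℝ)) F) ≤ capCompact p F ^ p := by
  have hp0 : 0 < p := by positivity
  rw [← ENNReal.rpow_inv_le_iff hp0]
  refine le_iInf fun φ => le_iInf fun hφ => le_iInf fun _ => le_iInf fun hF => ?_
  have hd : Continuous (partialDeriv j φ) :=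
    (hφ.continuous_fderiv (by simp)).clm_apply continuous_const
  have hnorm (f : EuclideanSpace ℝ (Fin N) → ℝ) :
      eLpNorm f (ENNReal.ofReal p) volume = (∫⁻ x, ‖f x‖ₑ ^ p) ^ (1 / p) := by
    rw [eLpNorm_eq_lintegral_rpow_enorm_toReal (by simpa using hp0) ENNReal.ofReal_ne_top,
      ENNReal.toReal_ofReal hp0.le]
  calc _ ≤ (∫⁻ x, (‖φ x‖ₑ + ‖partialDeriv j φ x‖ₑ) ^ p) ^ (1 / p) := by
        rw [one_div]
        gcongr
        exact volume_shadow_le_lintegral_rpow (by simp) hp (hφ.of_le (by simp)) hF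
    _ ≤ eLpNorm φ (ENNReal.ofReal p) volume +
          eLpNorm (partialDeriv j φ) (ENNReal.ofReal p) volume := by
        rw [hnorm, hnorm]
        exact ENNReal.lintegral_Lp_add_le hφ.continuous.enorm.aemeasurable
          hd.enorm.aemeasurable hp
    _ ≤ _ := by
        gcongr
        exact Finset.single_le_sum (f := fun j => eLpNorm (partialDeriv j φ) _ volume)
          (fun _ _ => zero_le) (Finset.mem_univ j)

theorem volume_shadow_le_capOpen (hp : 1 ≤ p) {U : Set (EuclideanSpace ℝ (Fin N))}
    (hU : IsOpen U) :
    volume (shadow (EuclideanSpace.single j (1 : ℝ)) U) ≤ capOpen p U ^ p := by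
  obtain ⟨F, hFc, hFU, hF, hFm⟩ := hU.exists_iUnion_isClosed
  let C (n : ℕ) : Set (EuclideanSpace ℝ (Fin N)) := F n ∩ Metric.closedBall 0 n
  have hCm : Monotone C := fun m n hmn =>
    inter_subset_inter (hFm hmn) (Metric.closedBall_subset_closedBall (Nat.cast_le.2 hmn))
  have hC : ⋃ n, C n = U := by
    rw [iUnion_inter_of_monotone hFm fun _ _ hmn =>
      Metric.closedBall_subset_closedBall (Nat.cast_le.2 hmn), hF,
      Metric.iUnion_closedBall_nat, inter_univ]
  have hshadow : shadow (EuclideanSpace.single j (1 : ℝ)) U =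
      ⋃ n, shadow (EuclideanSpace.single j (1 : ℝ)) (C n) := by
    ext y
    simp only [← hC, shadow, mem_iUnion, mem_ofPred_eq]
    exact exists_comm
  have hmono : Monotone fun n => shadow (EuclideanSpace.single j (1 : ℝ)) (C n) :=
    fun _ _ hmn _ ⟨t, ht⟩ => ⟨t, hCm hmn ht⟩
  rw [hshadow, hmono.measure_iUnion]
  refine iSup_le fun n => (volume_shadow_le_capCompact j hp (C n)).trans ?_
  gcongr
  exact le_iSup₂_of_le (C n) ((isCompact_closedBall 0 (n : ℝ)).inter_left (hFc n)) <|
    le_iSup_of_le (inter_subset_left.trans (hFU n)) le_rfl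

theorem ae_continuous_line_of_mem_quasicontinuous (hp : 1 ≤ p)
    {u : EuclideanSpace ℝ (Fin N) → ℝ} (hu : u ∈ quasicontinuous N p) :
    ∀ᵐ y : (ℝ ∙ EuclideanSpace.single j (1 : ℝ))ᗮ,
      Continuous fun t : ℝ => u (y + t • EuclideanSpace.single j (1 : ℝ)) := by
  have hp0 : 0 < p := by positivity
  refine ae_iff.2 (nonpos_iff_eq_zero.1 (le_of_forall_gt fun δ hδ => ?_))
  obtain ⟨U, hU, hcap, hcont⟩ := hu.2 (δ ^ p⁻¹) (ENNReal.rpow_pos_of_nonneg hδ (by positivity))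
  calc _ ≤ volume (shadow (EuclideanSpace.single j (1 : ℝ)) U) := by
        refine measure_mono fun y hy => ?_
        by_contra hyU
        exact hy (hcont.comp_continuous (by fun_prop) fun t ht => hyU ⟨t, ht⟩)
    _ ≤ capOpen p U ^ p := volume_shadow_le_capOpen j hp hU
    _ < δ := (ENNReal.lt_rpow_inv_iff hp0).1 hcap

end Capacity

section Removability

variable {N : ℕ} {p : ℝ} {K : Set (EuclideanSpace ℝ (Fin N))}

theorem lineMeasure_eq_volume (v : EuclideanSpace ℝ (Fin N)) : lineMeasure v = volume :=
  OrthonormalBasis.addHaar_eq_volume _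

theorem mem_countableLines_of_countable_inter_lineThrough {v : EuclideanSpace ℝ (Fin N)}
    (hv : v ≠ 0) {y : (ℝ ∙ v)ᗮ}
    (h : (K ∩ lineThrough (y : EuclideanSpace ℝ (Fin N)) v).Countable) :
    y ∈ countableLines v K := by
  have hinj : Function.Injective fun t : ℝ => (y : EuclideanSpace ℝ (Fin N)) + t • v :=
    (add_right_injective _).comp (smul_left_injective ℝ hv)
  have hsub : {t : ℝ | (y : EuclideanSpace ℝ (Fin N)) + t • v ∈ K} ⊆
      (fun t : ℝ => (y : EuclideanSpace ℝ (Fin N)) + t • v) ⁻¹' (K ∩ lineThrough y v) :=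
    fun t ht => ⟨ht, t, rfl⟩
  exact (h.preimage hinj).mono hsub

theorem mem_sobolev_univ_of_countable_lines (hN : 1 ≤ N) (hp : 1 ≤ p) (hK : IsClosed K)
    (hD : ∀ j : Fin N,
      volume.restrict (countableLines (EuclideanSpace.single j (1 : ℝ)) K) = volume)
    {u : EuclideanSpace ℝ (Fin N) → ℝ}
    (huc : ∀ j : Fin N, ∀ᵐ y : (ℝ ∙ EuclideanSpace.single j (1 : ℝ))ᗮ,
      Continuous fun t : ℝ => u (y + t • EuclideanSpace.single j (1 : ℝ)))
    (hu : u ∈ sobolev p Kᶜ) : u ∈ sobolev p univ := by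
  have hp1 : 1 ≤ ENNReal.ofReal p := ENNReal.one_le_ofReal.2 hp
  have hK0 : volume K = 0 :=
    volume_eq_zero_of_countable_lines (by simp) hK.measurableSet (hD ⟨0, hN⟩)
  have hres : volume.restrict Kᶜ = (volume : Measure (EuclideanSpace ℝ (Fin N))) :=
    Measure.restrict_eq_self_of_ae_mem (measure_eq_zero_iff_ae_notMem.1 hK0)
  simp only [sobolev, mem_ofPred_eq, hres, Measure.restrict_univ, isWeakPartialDeriv_iff] at hu ⊢
  refine ⟨hu.1, fun j => ?_⟩
  obtain ⟨g, hg, hw⟩ := hu.2 j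
  exact ⟨g, hg, hw.univ_of_countable_lines (by simp) hK.isOpen_compl
    (by rw [compl_compl]; exact hD j) (hu.1.locallyIntegrable hp1) (hg.locallyIntegrable hp1)
    (huc j)⟩

theorem inter_sobolev_compl_eq_inter_sobolev_univ (hN : 1 ≤ N) (hp : 1 ≤ p) (hK : IsClosed K)
    (hD : ∀ j : Fin N,
      volume.restrict (countableLines (EuclideanSpace.single j (1 : ℝ)) K) = volume)
    {C : Set (EuclideanSpace ℝ (Fin N) → ℝ)}
    (hC : ∀ u ∈ C, ∀ j : Fin N, ∀ᵐ y : (ℝ ∙ EuclideanSpace.single j (1 : ℝ))ᗮ,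
      Continuous fun t : ℝ => u (y + t • EuclideanSpace.single j (1 : ℝ))) :
    C ∩ sobolev p Kᶜ = C ∩ sobolev p univ :=
  Subset.antisymm
    (fun u hu => ⟨hu.1, mem_sobolev_univ_of_countable_lines hN hp hK hD (hC u hu.1) hu.2⟩)
    (inter_subset_inter_right C (sobolev_anti (subset_univ _)))

end Removability

end SobolevRemovability

open SobolevRemovability in
theorem corollary1p8_general :
    (∀ (N : ℕ) (_ : 1 ≤ N) (p : ℝ) (_ : 1 ≤ p) (K : Set (EuclideanSpace ℝ (Fin N)))
      (_ : IsClosed K) (_ : ¬ JProperty p K ∨ ¬ JPropertyCont p K),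
      ∃ j : Fin N, ∃ A : Set (ℝ ∙ EuclideanSpace.single j (1 : ℝ))ᗮ,
        MeasurableSet A ∧ 0 < lineMeasure (EuclideanSpace.single j 1) A ∧
        ∀ y ∈ A, ¬ (K ∩ lineThrough (y : EuclideanSpace ℝ (Fin N))
          (EuclideanSpace.single j 1)).Countable) ∧
    (∀ f : ℝ → ℝ, Continuous f → (∃ a b, f a ≠ f b) → ¬ (singularSupport f).Countable) := by
  refine ⟨fun N hN p hp K hK hfail => ?_, fun f hf hne => not_countable_singularSupport hf hne⟩
  by_contra! hno
  have hD (j : Fin N) :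
      volume.restrict (countableLines (EuclideanSpace.single j (1 : ℝ)) K) = volume := by
    refine restrict_eq_self_of_forall_exists_mem fun A hA hpos => ?_
    obtain ⟨y, hyA, hy⟩ := hno j A hA (by rwa [lineMeasure_eq_volume])
    exact ⟨y, hyA, mem_countableLines_of_countable_inter_lineThrough (by simp) hy⟩
  refine hfail.elim (· ?_) (· ?_)
  · exact inter_sobolev_compl_eq_inter_sobolev_univ hN hp hK hD fun u hu j =>
      ae_continuous_line_of_mem_quasicontinuous j hp hu
  · exact inter_sobolev_compl_eq_inter_sobolev_univ hN hp hK hD fun u hu j =>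
      .of_forall fun y => Continuous.comp hu (by fun_prop)

theorem corollary1p8 :
    (∀ (N : ℕ) (_ : 1 ≤ N) (p : ℝ) (_ : 1 ≤ p) (K : Set (EuclideanSpace ℝ (Fin N)))
      (_ : IsCompact K)
      (_ : ¬ SobolevRemovability.JProperty p K ∨ ¬ SobolevRemovability.JPropertyCont p K),
      ∃ v : EuclideanSpace ℝ (Fin N), v ≠ 0 ∧
        ∃ A : Set ((Submodule.span ℝ {v})ᗮ : Submodule ℝ (EuclideanSpace ℝ (Fin N))),
          MeasurableSet A ∧ 0 < SobolevRemovability.lineMeasure v A ∧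
          ∀ y ∈ A, ¬ (K ∩ SobolevRemovability.lineThrough
            (y : EuclideanSpace ℝ (Fin N)) v).Countable) ∧
    (∀ f : ℝ → ℝ, SobolevRemovability.IsSingularFunction f →
      ¬ (SobolevRemovability.singularSupport f).Countable) := by
  refine ⟨fun N hN p hp K hK hfail => ?_, fun f hf => corollary1p8_general.2 f hf.1 hf.2.1⟩
  obtain ⟨j, hj⟩ := corollary1p8_general.1 N hN p hp K hK.isClosed hfail
  exact ⟨EuclideanSpace.single j 1, by simp, hj⟩
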